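/- Fix noise levels $\sigma_p,\sigma_\theta>0$ and put $\Omega=\operatorname{diag}(\sigma_p^{-2},\sigma_p^{-2},\sigma_\theta^{-2})$. A planar pose graph consists of nominal poses $x_i=(p_i,\theta_i)\in\mathbb R^2\times\mathbb R$, $i=0,\dots,n-1$, and a connected simple undirected graph $G=(V,E)$ on $V=\{0,\dots,n-1\}$, each edge of which carries one relative pose measurement, taken in one direction $(i,j)$, with noise covariance $\Omega^{-1}$ and measurement function $$h_{ij}(X)=\big(R(\theta_i)^{\top}(p_j-p_i),\ \theta_j-\theta_i\big),$$ where $R(\theta)$ is the rotation by $\theta$. The pose $x_0$ is known and $X=(x_1,\dots,x_{n-1})$ is estimated. Let $H=\partial h/\partial X$ be the Jacobian of the stacked measurement function at the nominal poses, $\Sigma$ the diagonal covariance of the stacked noise, and $I=H^{\top}\Sigma^{-1}H$ the information matrix. Let $\mathcal A$ be a set of candidate actions, each $\mathcal U\in\mathcal A$ determining a planar pose graph (its posterior factor graph), whose number of nodes $n=n(\mathcal U)$, poses and edges may depend on $\mathcal U$. The objective is the entropy of the Gaussian posterior belief with covariance $I^{-1}$, $$J(\mathcal U)=\tfrac{3(n-1)}2\ln(2\pi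 e)+\tfrac12\ln\det\big(I^{-1}\big).$$ Let $t(G)$ be the number of spanning trees of $G$, $\tau(G)=\ln t(G)$, and let $$s_{ST}(\mathcal U)=\tfrac32\,\tau(G)+\tfrac{n-1}2\left[\ln\det\Omega-\ln(2\pi e)^{3}\right]$$ be the spanning-tree metric. Let $\tilde L$ be the Laplacian of $G$ with the row and the column of an arbitrary node $r=r(\mathcal U)$ removed, and $\Psi=(\sigma_\theta/\sigma_p)^2\max_{i\in V}\sum_{j:\{i,j\}\in E}\|p_i-p_j\|^2$. Put $$\mathcal{UB}[J(\mathcal U)]=-s_{ST}(\mathcal U),\qquad \mathcal{LB}[J(\mathcal U)]=-s_{ST}(\mathcal U)-\tfrac12\ln\det(\tilde L+\Psi\,\mathrm{Id})+\tfrac12\,\tau(G).$$ Then $\mathcal{LB}[J(\mathcal U)]\le J(\mathcal U)\le\mathcal{UB}[J(\mathcal U)]$ for every $\mathcal U\in\mathcal A$. Moreover, let $\mathcal U^\star$ be any minimizer of $J$ and $\hat{\mathcal U}$ any maximizer of $s_{ST}$ over $\mathcal A$, and suppose that $\min_{\mathcal U}\mathcal{LB}[J(\mathcal U)]$ exists (all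 three exist automatically if $\mathcal A$ is finite and non-empty). Then the error $\epsilon(J,s_{ST})=|J(\mathcal U^\star)-J(\hat{\mathcal U})|$ satisfies $$\epsilon(J,s_{ST})\le\Delta J_{\max}:=\mathcal{UB}[J(\hat{\mathcal U})]-\min_{\mathcal U\in\mathcal A}\mathcal{LB}[J(\mathcal U)].$$ -/

import Mathlib

namespace TBSP

noncomputable section

/-- A planar pose graph with poses `x₀, …, x_N` (so `n = N + 1` nodes).
`pose i = (x, y, θ)` is the nominal (maximum likelihood) value of the `i`-th pose, and
`(i, j) ∈ meas` means that the pose of `j` relative to `i` is measured. Each edge of the underlying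
simple graph carries one measurement, in one direction (`simple` also excludes loops).
Connectedness always holds when the consecutive poses are linked by odometry. -/
structure PoseGraph (N : ℕ) where
  pose : Fin (N + 1) → Fin 3 → ℝ
  meas : Finset (Fin (N + 1) × Fin (N + 1))
  simple : ∀ i j, (i, j) ∈ meas → (j, i) ∉ meas
  connected : (SimpleGraph.fromRel fun i j => (i, j) ∈ meas).Connected

/-- The relative pose `⊖ x ⊕ y` in `SE(2)`, i.e. `(R(θₓ)ᵀ (p_y - p_x), θ_y - θ_x)`. -/
def relPose (x y : Fin 3 → ℝ) : Fin 3 → ℝ :=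
  ![Real.cos (x 2) * (y 0 - x 0) + Real.sin (x 2) * (y 1 - x 1),
    -Real.sin (x 2) * (y 0 - x 0) + Real.cos (x 2) * (y 1 - x 1),
    y 2 - x 2]

/-- Information matrix `Ω = diag(σ_p⁻², σ_p⁻², σ_θ⁻²)` of one relative pose measurement. -/
def edgeInfo (σp σθ : ℝ) : Matrix (Fin 3) (Fin 3) ℝ :=
  Matrix.diagonal ![(σp ^ 2)⁻¹, (σp ^ 2)⁻¹, (σθ ^ 2)⁻¹]

namespace PoseGraph

variable {N : ℕ}

/-- The topology: the underlying simple undirected graph. -/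
def graph (P : PoseGraph N) : SimpleGraph (Fin (N + 1)) :=
  SimpleGraph.fromRel fun i j => (i, j) ∈ P.meas

/-- The number of spanning trees `t(G)`. -/
def numSpanningTrees (P : PoseGraph N) : ℕ :=
  {T : SimpleGraph (Fin (N + 1)) | T ≤ P.graph ∧ T.IsTree}.ncard

/-- `τ(G) = ln t(G)`. -/
def tau (P : PoseGraph N) : ℝ := Real.log P.numSpanningTrees

open Classical in
/-- The reduced Laplacian: the graph Laplacian with row and column `r` removed. -/
def reducedLaplacian (P : PoseGraph N) (r : Fin (N + 1)) : Matrix (Fin N) (Fin N) ℝ :=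
  (P.graph.lapMatrix ℝ).submatrix r.succAbove r.succAbove

/-- The whole trajectory, given the estimated poses `x₁, …, x_N`; `x₀` is fixed. -/
def trajectory (P : PoseGraph N) (X : Fin N × Fin 3 → ℝ) : Fin (N + 1) → Fin 3 → ℝ :=
  Fin.cons (P.pose 0) fun i a => X (i, a)

/-- The stacked measurement function `h`. -/
def measFun (P : PoseGraph N) (X : Fin N × Fin 3 → ℝ) : P.meas × Fin 3 → ℝ :=
  fun ea => relPose (P.trajectory X ea.1.1.1) (P.trajectory X ea.1.1.2) ea.2

/-- The nominal value of the estimated poses. -/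
def estimate (P : PoseGraph N) : Fin N × Fin 3 → ℝ := fun ia => P.pose ia.1.succ ia.2

/-- The measurement Jacobian `H = ∂h/∂X`, evaluated at the estimate. -/
def jacobian (P : PoseGraph N) : Matrix (P.meas × Fin 3) (Fin N × Fin 3) ℝ :=
  LinearMap.toMatrix' (fderiv ℝ P.measFun P.estimate : (Fin N × Fin 3 → ℝ) →ₗ[ℝ] _)

/-- Covariance of the stacked measurement noise. -/
def noiseCov (P : PoseGraph N) (σp σθ : ℝ) : Matrix (P.meas × Fin 3) (P.meas × Fin 3) ℝ :=
  Matrix.diagonal fun ea => ![σp ^ 2, σp ^ 2, σθ ^ 2] ea.2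

/-- The information matrix `I(X) = Hᵀ Σ⁻¹ H` of the estimated poses. -/
def infoMatrix (P : PoseGraph N) (σp σθ : ℝ) : Matrix (Fin N × Fin 3) (Fin N × Fin 3) ℝ :=
  P.jacobian.transpose * (P.noiseCov σp σθ)⁻¹ * P.jacobian

/-- The covariance of the Gaussian posterior belief. -/
def posteriorCov (P : PoseGraph N) (σp σθ : ℝ) : Matrix (Fin N × Fin 3) (Fin N × Fin 3) ℝ :=
  (P.infoMatrix σp σθ)⁻¹

/-- The objective `J`: the entropy of the Gaussian posterior belief, of dimension `3N`. -/
def entropy (P : PoseGraph N) (σp σθ : ℝ) : ℝ :=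
  (3 * N : ℝ) / 2 * Real.log (2 * Real.pi * Real.exp 1)
    + 1 / 2 * Real.log (P.posteriorCov σp σθ).det

/-- The spanning-tree metric `s_ST`; here `N = n - 1` is the number of estimated poses. -/
def sST (P : PoseGraph N) (σp σθ : ℝ) : ℝ :=
  3 / 2 * P.tau
    + (N : ℝ) / 2 * (Real.log (edgeInfo σp σθ).det
        - Real.log ((2 * Real.pi * Real.exp 1) ^ 3))

open Classical in
/-- `dist_max² = max_i ∑_{j ~ i} ‖p_i - p_j‖²`, with `p_i` the position of the `i`-th pose. -/
def distMaxSq (P : PoseGraph N) : ℝ :=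
  Finset.univ.sup' Finset.univ_nonempty fun i : Fin (N + 1) =>
    ∑ j ∈ P.graph.neighborFinset i,
      ((P.pose i 0 - P.pose j 0) ^ 2 + (P.pose i 1 - P.pose j 1) ^ 2)

/-- `Ψ = ξ² dist_max²` with `ξ = σ_θ / σ_p`. -/
def psi (P : PoseGraph N) (σp σθ : ℝ) : ℝ := (σθ / σp) ^ 2 * P.distMaxSq

/-- The upper entropy bound. -/
def upperBound (P : PoseGraph N) (σp σθ : ℝ) : ℝ := -P.sST σp σθ

/-- The lower entropy bound, using the Laplacian reduced at node `r`. -/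
def lowerBound (P : PoseGraph N) (σp σθ : ℝ) (r : Fin (N + 1)) : ℝ :=
  -P.sST σp σθ
    - 1 / 2 * Real.log
        (P.reducedLaplacian r + P.psi σp σθ • (1 : Matrix (Fin N) (Fin N) ℝ)).det
    + 1 / 2 * P.tau

end PoseGraph

end

/-- The error `|J(U⋆) - J(Û)|` of deciding for `Û` instead of `U⋆`. -/
def decisionError {A : Type*} (J : A → ℝ) (Ustar Uhat : A) : ℝ := |J Ustar - J Uhat|

end TBSP

/-! Write a = σ_p⁻², c = σ_θ⁻², and L for the reduced Laplacian. Both translational noises are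
equal, so rotating the translational rows of each edge into the global frame leaves the information
matrix unchanged. With coordinates sorted into x, y and headings, it has the blocks diag(aL, aL), a
coupling B, and a heading block cL + D, where D is diagonal and collects a times the squared lengths
of the edges measured from each node.

Setting c = 0 still gives a Gram matrix, so D - Bᵀ diag(aL, aL)⁻¹ B is positive semidefinite. Hence
the full Schur complement lies between cL and cL + D in the Loewner order, and D is at most a ·
dist_max² · Id. Monotonicity of the determinant (`Matrix.PosDef.det_le_det_add`) and the matrix-tree
theorem det L = t(G) (`det_updateRow_lapMatrix`) place the determinant between a^(2N) c^N t(G)³ and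
a^(2N) c^N t(G)² det(L + Ψ Id). Logarithms turn these into the two entropy bounds.

L may be reduced at any node r although pose 0 is the known one, so the determinant must not depend
on the anchor (`det_anchoredInfo_eq`). The error bound then follows from the upper bound at Û and
the lower bound at U⋆. -/

/-! ### Determinant inequalities for positive definite and block matrices -/

open scoped MatrixOrder Matrix in
/-- Adding a positive semidefinite matrix to the identity does not lower the determinant below 1. -/
theorem Matrix.PosSemidef.one_le_det_one_add {m : Type*} [Fintype m] [DecidableEq m]
    {P : Matrix m m ℝ} (hP : P.PosSemidef) : 1 ≤ (1 + P).det := by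
  have hH : (1 + P).IsHermitian := Matrix.isHermitian_one.add hP.1
  rw [hH.det_eq_prod_eigenvalues]
  refine Finset.prod_const_one.symm.le.trans
    (Finset.prod_le_prod (fun _ _ => zero_le_one) fun i _ => ?_)
  have h := hH.eigenvalues_eq i
  have hn : star (hH.eigenvectorBasis i).ofLp ⬝ᵥ (hH.eigenvectorBasis i).ofLp = (1 : ℝ) := by
    have h1 := hH.eigenvectorBasis.orthonormal.1 i
    rw [EuclideanSpace.norm_eq, Real.sqrt_eq_one] at h1
    simpa [dotProduct, sq] using h1
  have hp := hP.dotProduct_mulVec_nonneg (hH.eigenvectorBasis i).ofLp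
  rw [Matrix.add_mulVec, Matrix.one_mulVec, dotProduct_add, hn] at h
  simp only [RCLike.re_to_real] at h
  simp only [RCLike.ofReal_real_eq_id, id_eq]
  linarith

open scoped MatrixOrder Matrix in
/-- The determinant is monotone in the Loewner order. -/
theorem Matrix.PosDef.det_le_det_add {m : Type*} [Fintype m] [DecidableEq m]
    {A E : Matrix m m ℝ} (hA : A.PosDef) (hE : E.PosSemidef) : A.det ≤ (A + E).det := by
  -- Factoring A = SᴴS reduces the claim, by congruence with S, to the case A = 1.
  obtain ⟨S, hS⟩ := CStarAlgebra.nonneg_iff_eq_star_mul_self.mp hA.posSemidef.nonneg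
  have hd : A.det = S.det * S.det := by
    rw [hS, Matrix.det_mul, Matrix.star_eq_conjTranspose, Matrix.det_conjTranspose, star_trivial]
  have hS0 : IsUnit S.det := by
    rw [isUnit_iff_ne_zero]
    intro h0
    have := hA.det_pos
    simp [hd, h0] at this
  have h1 : A + E = star S * (1 + (S⁻¹)ᴴ * E * S⁻¹) * S := by
    have h2 : star S * (S⁻¹)ᴴ = 1 := by
      rw [Matrix.star_eq_conjTranspose, ← Matrix.conjTranspose_mul, Matrix.nonsing_inv_mul _ hS0,
        Matrix.conjTranspose_one]
    calc A + E = star S * S + (star S * (S⁻¹)ᴴ) * E * (S⁻¹ * S) := by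
          rw [h2, Matrix.nonsing_inv_mul _ hS0, ← hS, one_mul, mul_one]
      _ = _ := by noncomm_ring
  have h3 : (A + E).det = A.det * (1 + (S⁻¹)ᴴ * E * S⁻¹).det := by
    rw [h1, Matrix.det_mul, Matrix.det_mul, hd, Matrix.star_eq_conjTranspose,
      Matrix.det_conjTranspose, star_trivial]
    ring
  rw [h3]
  exact le_mul_of_one_le_right hA.det_pos.le
    (hE.conjTranspose_mul_mul_same S⁻¹).one_le_det_one_add

/-- Lower bound for the determinant of a block matrix, part of whose lower right block may be
split off. -/
theorem Matrix.det_mul_det_le_det_fromBlocks {m n : Type*} [Fintype m] [DecidableEq m] [Fintype n]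
    [DecidableEq n] {A : Matrix m m ℝ} {B : Matrix m n ℝ} {C D : Matrix n n ℝ} (hA : A.PosDef)
    (hC : C.PosDef) (h : (Matrix.fromBlocks A B B.transpose D).PosSemidef) :
    A.det * C.det ≤ (Matrix.fromBlocks A B B.transpose (C + D)).det := by
  let := hA.isUnit.invertible
  rw [← Matrix.conjTranspose_eq_transpose_of_trivial] at h ⊢
  -- `h` becomes positivity of the Schur complement D - Bᴴ A⁻¹ B, which is what is added to C in the
  -- determinant.
  rw [Matrix.PosDef.fromBlocks₁₁ _ _ hA] at h
  rw [Matrix.det_fromBlocks₁₁, Matrix.invOf_eq_nonsing_inv, add_sub_assoc]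
  exact mul_le_mul_of_nonneg_left (hC.det_le_det_add h) hA.det_pos.le

/-- Upper bound for the determinant of a block matrix (a form of Fischer's inequality). -/
theorem Matrix.det_fromBlocks_le_det_mul_det {m n : Type*} [Fintype m] [DecidableEq m] [Fintype n]
    [DecidableEq n] {A : Matrix m m ℝ} {B : Matrix m n ℝ} {C D : Matrix n n ℝ} (hA : A.PosDef)
    (hC : C.PosDef) (h : (Matrix.fromBlocks A B B.transpose D).PosSemidef) :
    (Matrix.fromBlocks A B B.transpose (C + D)).det ≤ A.det * (C + D).det := by
  let := hA.isUnit.invertible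
  rw [← Matrix.conjTranspose_eq_transpose_of_trivial] at h ⊢
  rw [Matrix.PosDef.fromBlocks₁₁ _ _ hA] at h
  rw [Matrix.det_fromBlocks₁₁, Matrix.invOf_eq_nonsing_inv, add_sub_assoc]
  refine mul_le_mul_of_nonneg_left ?_ hA.det_pos.le
  -- Adding this term back to the Schur complement restores C + D.
  have h1 : (B.conjTranspose * A⁻¹ * B).PosSemidef :=
    hA.inv.posSemidef.conjTranspose_mul_mul_same B
  simpa [add_assoc] using (hC.add_posSemidef h).det_le_det_add h1

/-! ### The matrix-tree theorem, by expansion over parent maps -/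

section MatrixTree

variable {V : Type*} [Fintype V] [DecidableEq V]

/-- The matrix `1 - F`, where `F` is the matrix of the map `f`, with row `r` replaced by a unit
vector. -/
def parentMatrix (r : V) (f : V → V) : Matrix V V ℝ :=
  Matrix.of fun v => if v = r then Pi.single r 1 else Pi.single v 1 - Pi.single (f v) 1

/-- Every `v ≠ r` is one step farther from `r` than `f v`. Grading vertices by the number of steps
makes the matrix block triangular with identity diagonal blocks. -/
theorem det_parentMatrix_of_forall {r : V} {f : V → V} (hr : f r = r)
    (h : ∀ v, ∃ n, f^[n] v = r) : (parentMatrix r f).det = 1 := by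
  have hlt : ∀ v, v ≠ r → Nat.find (h (f v)) < Nat.find (h v) := by
    intro v hv
    obtain ⟨n, hn⟩ : ∃ n, Nat.find (h v) = n + 1 := by
      refine Nat.exists_eq_succ_of_ne_zero fun h0 => hv ?_
      simpa [h0] using Nat.find_spec (h v)
    rw [hn, Nat.lt_succ_iff]
    refine Nat.find_min' _ ?_
    simpa [hn] using Nat.find_spec (h v)
  have hent : ∀ v u, Nat.find (h v) ≤ Nat.find (h u) →
      parentMatrix r f v u = (1 : Matrix V V ℝ) v u := by
    intro v u hvu
    by_cases hv : v = r
    · subst hv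
      simp [parentMatrix, Pi.single_apply, Matrix.one_apply, eq_comm]
    · have hfu : u ≠ f v := by
        rintro rfl
        exact absurd (hlt v hv) (not_lt.mpr hvu)
      simp only [parentMatrix, Matrix.of_apply, hv, if_false, Pi.sub_apply, Pi.single_apply,
        Matrix.one_apply, hfu, sub_zero]
      exact if_congr eq_comm rfl rfl
  have hb : (parentMatrix r f).BlockTriangular fun v => OrderDual.toDual (Nat.find (h v)) := by
    intro v u huv
    have huv' : Nat.find (h v) < Nat.find (h u) := huv
    rw [hent v u huv'.le, Matrix.one_apply_ne]
    rintro rfl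
    exact lt_irrefl _ huv'
  rw [hb.det]
  refine Finset.prod_eq_one fun a _ => ?_
  have hone : (parentMatrix r f).toSquareBlock
      (fun v => OrderDual.toDual (Nat.find (h v))) a = 1 := by
    ext ⟨v, hv⟩ ⟨u, hu⟩
    have hvu : Nat.find (h v) = Nat.find (h u) := hv.trans hu.symm
    simpa [Matrix.toSquareBlock_def, Matrix.one_apply] using hent v u hvu.le
  rw [hone, Matrix.det_one]

/-- The indicator of the vertices that never reach `r` is a nonzero kernel vector, because `u ≠ r`
belongs to that set exactly when `f u` does. -/
theorem det_parentMatrix_of_not_forall {r : V} {f : V → V}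
    (h : ¬ ∀ v, ∃ n, f^[n] v = r) : (parentMatrix r f).det = 0 := by
  classical
  push Not at h
  obtain ⟨v, hv⟩ := h
  refine Matrix.exists_mulVec_eq_zero_iff.mp
    ⟨fun u => if ∀ n, f^[n] u ≠ r then 1 else 0, fun h0 => ?_, ?_⟩
  · simpa [hv] using congrFun h0 v
  · ext u
    by_cases hu : u = r
    · subst hu
      have : ¬ ∀ n, f^[n] u ≠ u := fun h => h 0 rfl
      simp [parentMatrix, Matrix.mulVec, this]
    · have : (∀ n, f^[n] u ≠ r) ↔ ∀ n, f^[n] (f u) ≠ r := by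
        refine ⟨fun h n => h (n + 1), fun h n => ?_⟩
        cases n with
        | zero => exact hu
        | succ n => exact h n
      have hrow : parentMatrix r f u = Pi.single u 1 - Pi.single (f u) 1 :=
        if_neg hu
      rw [Matrix.mulVec, hrow, sub_dotProduct, single_dotProduct, single_dotProduct]
      simp only [this, sub_self, Pi.zero_apply]

/-- The graph in which every vertex is joined to its parent. -/
def parentGraph (f : V → V) : SimpleGraph V := SimpleGraph.fromRel fun u v => f u = v

omit [Fintype V] [DecidableEq V] in
theorem parentGraph_connected {r : V} {f : V → V} (h : ∀ v, ∃ n, f^[n] v = r) :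
    (parentGraph f).Connected := by
  have hreach : ∀ n v, (parentGraph f).Reachable v (f^[n] v) := by
    intro n
    induction n with
    | zero => exact fun v => SimpleGraph.Reachable.refl _
    | succ n ih =>
      intro v
      by_cases hv : v = f v
      · rw [Function.iterate_succ_apply, ← hv]
        exact ih v
      · have hadj : (parentGraph f).Adj v (f v) := by simp [parentGraph, hv]
        exact hadj.reachable.trans (ih (f v))
  have hr : ∀ v, (parentGraph f).Reachable v r := fun v => by
    obtain ⟨n, hn⟩ := h v
    exact hn ▸ hreach n v
  have : Nonempty V := ⟨r⟩
  exact ⟨fun u v => (hr u).trans (hr v).symm⟩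

/-- The graph is connected, and each edge is `s(v, f v)` for some `v ≠ r`, so there are at most |V|
- 1 edges. -/
theorem parentGraph_isTree {r : V} {f : V → V} (hr : f r = r) (h : ∀ v, ∃ n, f^[n] v = r) :
    (parentGraph f).IsTree := by
  have hc := parentGraph_connected h
  refine SimpleGraph.isTree_iff_connected_and_card.mpr
    ⟨hc, le_antisymm ?_ hc.card_vert_le_card_edgeSet_add_one⟩
  have hsub : (parentGraph f).edgeSet ⊆ ((Finset.univ.erase r).image fun v => s(v, f v) :
      Finset (Sym2 V)) := by
    intro e
    induction e with
    | _ u v =>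
      intro he
      rw [SimpleGraph.mem_edgeSet, parentGraph, SimpleGraph.fromRel_adj] at he
      obtain ⟨hne, rfl | rfl⟩ := he
      · simp only [Finset.coe_image, Set.mem_image]
        refine ⟨u, ?_, rfl⟩
        simp only [Finset.coe_erase, Finset.coe_univ, Set.mem_sdiff, Set.mem_univ,
          Set.mem_singleton_iff, true_and]
        rintro rfl
        exact hne hr.symm
      · simp only [Finset.coe_image, Set.mem_image]
        refine ⟨v, ?_, Sym2.eq_swap⟩
        simp only [Finset.coe_erase, Finset.coe_univ, Set.mem_sdiff, Set.mem_univ,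
          Set.mem_singleton_iff, true_and]
        rintro rfl
        exact hne hr
  have hcard := (Set.ncard_le_ncard hsub (Finset.finite_toSet _)).trans
    ((Set.ncard_coe_finset _).trans_le Finset.card_image_le)
  rw [Finset.card_erase_of_mem (Finset.mem_univ r), Finset.card_univ] at hcard
  rw [← Nat.card_coe_set_eq] at hcard
  have hpos : 0 < Fintype.card V := Fintype.card_pos_iff.mpr ⟨r⟩
  rw [Nat.card_eq_fintype_card (α := V)]
  omega

-- Induction on the number of steps to the root: if `g v ≠ f v`, the edge from `v` to `f v` can only
-- come from `g (f v) = v`. But `g (f v) = f (f v)` by induction, and a 2-cycle of `f` never reaches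
-- `r`.
omit [Fintype V] [DecidableEq V] in
theorem parentGraph_injOn {r : V} {f g : V → V} (hf : f r = r) (hg : g r = r)
    (h : ∀ v, ∃ n, f^[n] v = r) (hfg : parentGraph f = parentGraph g) : f = g := by
  classical
  have hno2 : ∀ v, v ≠ r → f (f v) ≠ v := by
    intro v hv hvv
    have hall : ∀ n, f^[n] v ≠ r ∧ f^[n] (f v) ≠ r := by
      intro n
      induction n with
      | zero =>
        refine ⟨hv, fun h0 => hv ?_⟩
        simp only [Function.iterate_zero, id_eq] at h0
        rw [← hvv, h0, hf]
      | succ n ih =>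
        refine ⟨by simpa using ih.2, ?_⟩
        rw [Function.iterate_succ_apply, hvv]
        exact ih.1
    obtain ⟨n, hn⟩ := h v
    exact (hall n).1 hn
  have key : ∀ n v, f^[n] v = r → f v = g v := by
    intro n
    induction n with
    | zero =>
      rintro v rfl
      simp only [Function.iterate_zero, id_eq] at hf hg
      rw [hf, hg]
    | succ n ih =>
      intro v hv
      by_cases hvr : v = r
      · rw [hvr, hf, hg]
      by_contra hne
      have hw := ih (f v) hv
      have hvf : v ≠ f v := fun h0 => hno2 v hvr (by rw [← h0, ← h0])
      have hadj : (parentGraph f).Adj v (f v) := by simp [parentGraph, hvf]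
      rw [hfg, parentGraph, SimpleGraph.fromRel_adj] at hadj
      rcases hadj.2 with h1 | h1
      · exact hne h1.symm
      · exact hno2 v hvr (hw.trans h1)
  funext v
  obtain ⟨n, hn⟩ := h v
  exact key n v hn

omit [Fintype V] [DecidableEq V] in
/-- Every tree is the parent graph of the map towards a given root. -/
theorem exists_parentGraph_eq {T : SimpleGraph V} (hT : T.IsTree) (r : V) :
    ∃ f : V → V, f r = r ∧ (∀ v, v ≠ r → T.Adj v (f v)) ∧ (∀ v, ∃ n, f^[n] v = r) ∧
      parentGraph f = T := by
  classical
  -- The parent is the second vertex of a shortest walk to `r`.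
  have hstep : ∀ v, ∃ w, v ≠ r → T.Adj v w ∧ T.dist w r < T.dist v r := by
    intro v
    by_cases hv : v = r
    · exact ⟨v, fun h => absurd hv h⟩
    obtain ⟨p, hp⟩ := hT.1.exists_walk_length_eq_dist v r
    cases p with
    | nil => exact absurd rfl hv
    | cons hadj q =>
      refine ⟨_, fun _ => ⟨hadj, ?_⟩⟩
      have := SimpleGraph.dist_le q
      rw [SimpleGraph.Walk.length_cons] at hp
      omega
  choose w hw using hstep
  refine ⟨fun v => if v = r then r else w v, by simp, fun v hv => by simpa [hv] using (hw v hv).1,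
    ?_⟩
  set f : V → V := fun v => if v = r then r else w v with hf
  have hreach : ∀ v, ∃ n, f^[n] v = r := by
    intro v
    induction hn : T.dist v r using Nat.strong_induction_on generalizing v with
    | _ n ih =>
      by_cases hv : v = r
      · exact ⟨0, hv⟩
      have hfv : f v = w v := by simp [hf, hv]
      obtain ⟨k, hk⟩ := ih _ (hn ▸ (hw v hv).2) (w v) rfl
      exact ⟨k + 1, by rw [Function.iterate_succ_apply, hfv, hk]⟩
  refine ⟨hreach, ?_⟩
  have hle : parentGraph f ≤ T := by
    have h1 : ∀ u, u ≠ f u → T.Adj u (f u) := by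
      intro u hu
      by_cases hur : u = r
      · exact absurd (by simp [hf, hur]) hu
      · simpa [hf, hur] using (hw u hur).1
    intro u v huv
    rw [parentGraph, SimpleGraph.fromRel_adj] at huv
    obtain ⟨hne, rfl | rfl⟩ := huv
    · exact h1 u hne
    · exact (h1 v hne.symm).symm
  -- A tree is minimal among connected graphs, so a connected subgraph exhausts it.
  exact le_antisymm hle
    ((SimpleGraph.isTree_iff_minimal_connected.mp hT).2 (parentGraph_connected hreach) hle)

/-- **Matrix-tree theorem**, for the Laplacian with row `r` replaced by a unit vector. -/
theorem det_updateRow_lapMatrix (G : SimpleGraph V) [DecidableRel G.Adj] (r : V) :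
    ((G.lapMatrix ℝ).updateRow r (Pi.single r 1)).det =
      {T : SimpleGraph V | T ≤ G ∧ T.IsTree}.ncard := by
  classical
  -- Row `v ≠ r` of the Laplacian is the sum of e_v - e_j over the neighbours j. Multilinearity
  -- expands the determinant over all choices of one neighbour per vertex; the singleton at `r`
  -- forces `f r = r`.
  let S : V → Finset V := fun v => if v = r then {r} else G.neighborFinset v
  let row : V → V → V → ℝ := fun v j =>
    if v = r then Pi.single r 1 else Pi.single v 1 - Pi.single j 1
  have hrows : (G.lapMatrix ℝ).updateRow r (Pi.single r 1) = fun v => ∑ j ∈ S v, row v j := by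
    funext v u
    by_cases hv : v = r
    · subst hv
      simp [S, row]
    · simp only [Matrix.updateRow_ne hv, S, row, hv, if_false, Finset.sum_apply, Pi.sub_apply,
        Finset.sum_sub_distrib, Finset.sum_const, SimpleGraph.card_neighborFinset_eq_degree,
        Pi.single_apply, Finset.sum_ite_eq, SimpleGraph.mem_neighborFinset]
      by_cases huv : u = v
      · simp [SimpleGraph.lapMatrix, SimpleGraph.degMatrix, huv]
      · simp [SimpleGraph.lapMatrix, SimpleGraph.degMatrix, huv, Ne.symm huv,
          SimpleGraph.adjMatrix_apply]
  have hexp : ((G.lapMatrix ℝ).updateRow r (Pi.single r 1)).det =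
      ∑ f ∈ Fintype.piFinset S, (parentMatrix r f).det := by
    rw [hrows]
    exact (Matrix.detRowAlternating (R := ℝ) (n := V)).toMultilinearMap.map_sum_finset row S
  have hS : ∀ f ∈ Fintype.piFinset S, f r = r ∧ ∀ v, v ≠ r → G.Adj v (f v) := by
    intro f hf
    rw [Fintype.mem_piFinset] at hf
    refine ⟨by simpa [S] using hf r, fun v hv => by simpa [S, hv] using hf v⟩
  have hdet : ∀ f ∈ Fintype.piFinset S,
      (parentMatrix r f).det = if ∀ v, ∃ n, f^[n] v = r then 1 else 0 := by
    intro f hf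
    split_ifs with h
    · exact det_parentMatrix_of_forall (hS f hf).1 h
    · exact det_parentMatrix_of_not_forall h
  rw [hexp, Finset.sum_congr rfl hdet, ← Finset.sum_filter, Finset.sum_const, nsmul_one,
    Nat.cast_inj, ← Set.ncard_coe_finset]
  refine Set.ncard_congr (fun f _ => parentGraph f) ?_ ?_ ?_
  · intro f hf
    rw [Finset.mem_coe, Finset.mem_filter] at hf
    obtain ⟨hr, hadj⟩ := hS f hf.1
    refine ⟨?_, parentGraph_isTree hr hf.2⟩
    have h1 : ∀ u, u ≠ f u → G.Adj u (f u) := by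
      intro u hu
      refine hadj u ?_
      rintro rfl
      exact hu hr.symm
    intro u v huv
    rw [parentGraph, SimpleGraph.fromRel_adj] at huv
    obtain ⟨hne, rfl | rfl⟩ := huv
    · exact h1 u hne
    · exact (h1 v hne.symm).symm
  · intro f g hf hg hfg
    rw [Finset.mem_coe, Finset.mem_filter] at hf hg
    exact parentGraph_injOn (hS f hf.1).1 (hS g hg.1).1 hf.2 hfg
  · rintro T ⟨hTG, hT⟩
    obtain ⟨f, hr, hadj, hreach, rfl⟩ := exists_parentGraph_eq hT r
    refine ⟨f, ?_, rfl⟩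
    rw [Finset.mem_coe, Finset.mem_filter, Fintype.mem_piFinset]
    refine ⟨fun v => ?_, hreach⟩
    by_cases hv : v = r
    · simp [S, hv, hr]
    · simpa [S, hv] using hTG (hadj v hv)

end MatrixTree

/-! ### The measurement Jacobian and the information matrix -/

namespace TBSP
namespace PoseGraph

variable {N : ℕ}

/-- The signed incidence of a directed edge and a node. -/
noncomputable def incidence (e : Fin (N + 1) × Fin (N + 1)) (v : Fin (N + 1)) : ℝ :=
  (if v = e.2 then 1 else 0) - if v = e.1 then 1 else 0

/-- The derivative of the displacement along `e`, seen from the frame of its source, with respect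
to the heading of the source. -/
def lever (P : PoseGraph N) (e : Fin (N + 1) × Fin (N + 1)) : Fin 3 → ℝ :=
  ![P.pose e.2 1 - P.pose e.1 1, -(P.pose e.2 0 - P.pose e.1 0), 0]

/-- The measurement Jacobian with respect to all poses, with the measured translations rotated
into the global frame. -/
noncomputable def globalJacobian (P : PoseGraph N) :
    Matrix (P.meas × Fin 3) (Fin (N + 1) × Fin 3) ℝ :=
  Matrix.of fun ea vb => (if ea.2 = vb.2 then incidence ea.1.1 vb.1 else 0)
    + if vb.1 = ea.1.1.1 ∧ vb.2 = 2 then P.lever ea.1.1 ea.2 else 0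

/-- The Jacobian with the pose of node `r` held fixed. -/
noncomputable def anchoredJacobian (P : PoseGraph N) (r : Fin (N + 1)) :
    Matrix (P.meas × Fin 3) (Fin N × Fin 3) ℝ :=
  P.globalJacobian.submatrix id (Prod.map r.succAbove id)

/-- The information matrix with weights `ω` and the pose of node `r` held fixed. -/
noncomputable def anchoredInfo (P : PoseGraph N) (r : Fin (N + 1)) (ω : Fin 3 → ℝ) :
    Matrix (Fin N × Fin 3) (Fin N × Fin 3) ℝ :=
  Matrix.transpose (P.anchoredJacobian r) * Matrix.diagonal (fun ea : P.meas × Fin 3 => ω ea.2) *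
    P.anchoredJacobian r

theorem transpose_mul_diagonal_mul_apply {P : PoseGraph N} {ι : Type*} [Fintype ι]
    (A : Matrix (P.meas × Fin 3) ι ℝ) (ω : Fin 3 → ℝ) (i j : ι) :
    (Matrix.transpose A * Matrix.diagonal (fun ea : P.meas × Fin 3 => ω ea.2) * A) i j =
      ∑ e, ∑ a, ω a * (A (e, a) i * A (e, a) j) := by
  rw [Matrix.mul_apply, Fintype.sum_prod_type]
  refine Finset.sum_congr rfl fun e _ => Finset.sum_congr rfl fun a _ => ?_
  rw [Matrix.mul_diagonal, Matrix.transpose_apply]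
  ring

theorem hasFDerivAt_trajectory (P : PoseGraph N) (X : Fin N × Fin 3 → ℝ) (v : Fin (N + 1))
    (a : Fin 3) :
    HasFDerivAt (fun X => P.trajectory X v a)
      (Fin.cases 0 (fun k => ContinuousLinearMap.proj (k, a)) v :
        (Fin N × Fin 3 → ℝ) →L[ℝ] ℝ) X := by
  cases v using Fin.cases with
  | zero => simpa [trajectory] using hasFDerivAt_const _ _
  | succ k =>
    simp only [trajectory, Fin.cons_succ, Fin.cases_succ]
    exact (ContinuousLinearMap.proj (R := ℝ) (φ := fun _ : Fin N × Fin 3 => ℝ) (k, a)).hasFDerivAt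

theorem trajectory_estimate (P : PoseGraph N) : P.trajectory P.estimate = P.pose := by
  funext v
  cases v using Fin.cases <;> rfl

theorem proj_single_apply (v : Fin (N + 1)) (a : Fin 3) (k : Fin N) (b : Fin 3) :
    (Fin.cases 0 (fun k => ContinuousLinearMap.proj (k, a)) v :
        (Fin N × Fin 3 → ℝ) →L[ℝ] ℝ) (Pi.single (k, b) 1) =
      if a = b then (if k.succ = v then 1 else 0) else 0 := by
  cases v using Fin.cases with
  | zero => simp [Fin.succ_ne_zero]
  | succ l =>
    by_cases hab : a = b <;> by_cases hkl : k = l <;> simp [hab, hkl, eq_comm]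

/-- The rotation R(θ)ᵀ of the source factors out of every derivative, including the one in θ, which
leaves the displacement turned by a right angle (`lever`). -/
theorem jacobian_apply (P : PoseGraph N) (e : P.meas) (k : Fin N) (b : Fin 3) :
    P.jacobian (e, 0) (k, b) =
        Real.cos (P.pose e.1.1 2) * P.anchoredJacobian 0 (e, 0) (k, b)
          + Real.sin (P.pose e.1.1 2) * P.anchoredJacobian 0 (e, 1) (k, b) ∧
      P.jacobian (e, 1) (k, b) =
        -Real.sin (P.pose e.1.1 2) * P.anchoredJacobian 0 (e, 0) (k, b)
          + Real.cos (P.pose e.1.1 2) * P.anchoredJacobian 0 (e, 1) (k, b) ∧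
      P.jacobian (e, 2) (k, b) = P.anchoredJacobian 0 (e, 2) (k, b) := by
  have hd := fun v a => P.hasFDerivAt_trajectory P.estimate v a
  have h0 := ((hd e.1.1 2).cos.mul ((hd e.1.2 0).sub (hd e.1.1 0))).add
    ((hd e.1.1 2).sin.mul ((hd e.1.2 1).sub (hd e.1.1 1)))
  have h1 := ((hd e.1.1 2).sin.neg.mul ((hd e.1.2 0).sub (hd e.1.1 0))).add
    ((hd e.1.1 2).cos.mul ((hd e.1.2 1).sub (hd e.1.1 1)))
  have h2 := (hd e.1.2 2).sub (hd e.1.1 2)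
  have hdiff : DifferentiableAt ℝ P.measFun P.estimate := by
    rw [differentiableAt_pi]
    rintro ⟨e, a⟩
    have hd' := fun v a => (P.hasFDerivAt_trajectory P.estimate v a).differentiableAt
    fin_cases a
    · exact ((hd' _ 2).cos.mul ((hd' _ 0).sub (hd' _ 0))).add
        ((hd' _ 2).sin.mul ((hd' _ 1).sub (hd' _ 1)))
    · exact ((hd' _ 2).sin.neg.mul ((hd' _ 0).sub (hd' _ 0))).add
        ((hd' _ 2).cos.mul ((hd' _ 1).sub (hd' _ 1)))
    · exact (hd' _ 2).sub (hd' _ 2)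
  have hcomp : ∀ (a : Fin 3) (L : (Fin N × Fin 3 → ℝ) →L[ℝ] ℝ),
      HasFDerivAt (fun X => P.measFun X (e, a)) L P.estimate →
      P.jacobian (e, a) (k, b) = L (Pi.single (k, b) 1) := by
    intro a L hL
    rw [jacobian, LinearMap.toMatrix'_apply]
    have := (hasFDerivAt_pi'.mp hdiff.hasFDerivAt (e, a)).unique hL
    rw [← this]
    rfl
  rw [hcomp 0 _ h0, hcomp 1 _ h1, hcomp 2 _ h2]
  simp only [Pi.sub_apply, Pi.neg_apply, add_apply, smul_apply, sub_apply, neg_apply,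
    proj_single_apply, trajectory_estimate, smul_eq_mul, anchoredJacobian, globalJacobian,
    Matrix.submatrix_apply, Matrix.of_apply, Prod.map_apply, id_eq, Fin.succAbove_zero, incidence,
    lever]
  refine ⟨?_, ?_, ?_⟩ <;> fin_cases b <;> simp <;> split_ifs <;> ring

theorem infoMatrix_eq (P : PoseGraph N) {σp σθ : ℝ} (hσp : 0 < σp) (hσθ : 0 < σθ) :
    P.infoMatrix σp σθ = P.anchoredInfo 0 ![(σp ^ 2)⁻¹, (σp ^ 2)⁻¹, (σθ ^ 2)⁻¹] := by
  have hinv : (P.noiseCov σp σθ)⁻¹ =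
      Matrix.diagonal fun ea => ![(σp ^ 2)⁻¹, (σp ^ 2)⁻¹, (σθ ^ 2)⁻¹] ea.2 := by
    refine Matrix.inv_eq_right_inv ?_
    rw [noiseCov, Matrix.diagonal_mul_diagonal, ← Matrix.diagonal_one]
    congr 1
    funext ⟨e, a⟩
    fin_cases a <;> simp <;> field_simp
  ext ⟨k, b⟩ ⟨l, c⟩
  rw [infoMatrix, hinv, anchoredInfo, transpose_mul_diagonal_mul_apply,
    transpose_mul_diagonal_mul_apply]
  refine Finset.sum_congr rfl fun e _ => ?_
  obtain ⟨h0, h1, h2⟩ := P.jacobian_apply e k b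
  obtain ⟨h0', h1', h2'⟩ := P.jacobian_apply e l c
  simp only [Fin.sum_univ_three, h0, h1, h2, h0', h1', h2', Matrix.cons_val_zero,
    Matrix.cons_val_one, Matrix.cons_val]
  -- The frame rotation cancels because both translational weights are equal.
  linear_combination (σp ^ 2)⁻¹ * (P.anchoredJacobian 0 (e, 0) (k, b)
    * P.anchoredJacobian 0 (e, 0) (l, c) + P.anchoredJacobian 0 (e, 1) (k, b)
    * P.anchoredJacobian 0 (e, 1) (l, c)) * Real.sin_sq_add_cos_sq (P.pose e.1.1 2)

/-- A sum over the neighbours of a node is a sum over the measurements. -/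
theorem sum_neighborFinset (P : PoseGraph N) [DecidableRel P.graph.Adj]
    (i : Fin (N + 1)) (g : Fin (N + 1) → ℝ) :
    ∑ j ∈ P.graph.neighborFinset i, g j =
      ∑ e : P.meas, ((if i = e.1.1 then g e.1.2 else 0) + if i = e.1.2 then g e.1.1 else 0) := by
  -- `simple` makes the two orientations exclusive, so no neighbour is counted twice.
  have hadj : ∀ j, (if P.graph.Adj i j then g j else 0) =
      (if (i, j) ∈ P.meas then g j else 0) + if (j, i) ∈ P.meas then g j else 0 := by
    intro j
    have h : P.graph.Adj i j ↔ (i, j) ∈ P.meas ∨ (j, i) ∈ P.meas := by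
      rw [graph, SimpleGraph.fromRel_adj]
      refine and_iff_right_of_imp ?_
      rintro h rfl
      have : (i, i) ∈ P.meas := by simpa using h
      exact P.simple i i this this
    have hs := P.simple i j
    by_cases h1 : (i, j) ∈ P.meas <;> by_cases h2 : (j, i) ∈ P.meas <;> simp_all
  have hsum : ∀ F : Fin (N + 1) × Fin (N + 1) → ℝ,
      ∑ e : P.meas, F e.1 = ∑ u, ∑ v, if (u, v) ∈ P.meas then F (u, v) else 0 := by
    intro F
    rw [Finset.sum_coe_sort P.meas F, ← Fintype.sum_prod_type'
      (f := fun u v => if (u, v) ∈ P.meas then F (u, v) else 0), Finset.sum_ite_mem,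
      Finset.univ_inter]
  rw [hsum fun e => (if i = e.1 then g e.2 else 0) + if i = e.2 then g e.1 else 0]
  rw [SimpleGraph.neighborFinset_eq_filter, Finset.sum_filter,
    Finset.sum_congr rfl fun j _ => hadj j, Finset.sum_add_distrib]
  have hsplit : ∀ u v, (if (u, v) ∈ P.meas then
      ((if i = u then g v else 0) + if i = v then g u else 0) else 0) =
      (if i = u then (if (u, v) ∈ P.meas then g v else 0) else 0) +
        if i = v then (if (u, v) ∈ P.meas then g u else 0) else 0 := by
    intro u v
    split_ifs <;> simp
  simp only [hsplit, Finset.sum_add_distrib]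
  congr 1
  · rw [Finset.sum_comm]
    simp
  · simp

end PoseGraph
end TBSP

/-! ### The reduced Laplacian and independence of the anchor -/

namespace TBSP
namespace PoseGraph

variable {N : ℕ}

theorem sum_incidence (e : Fin (N + 1) × Fin (N + 1)) : ∑ v, incidence e v = 0 := by
  simp [incidence]

theorem reducedLaplacian_apply (P : PoseGraph N) (r : Fin (N + 1)) (k l : Fin N) :
    P.reducedLaplacian r k l =
      ∑ e : P.meas, incidence e.1 (r.succAbove k) * incidence e.1 (r.succAbove l) := by
  classical
  set i := r.succAbove k
  set j := r.succAbove l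
  have hentry : P.reducedLaplacian r k l =
      ∑ u ∈ P.graph.neighborFinset i, ((if i = j then 1 else 0) - if u = j then 1 else 0) := by
    rw [reducedLaplacian, Matrix.submatrix_apply, Finset.sum_sub_distrib, Finset.sum_const,
      SimpleGraph.card_neighborFinset_eq_degree, Finset.sum_ite_eq', SimpleGraph.lapMatrix,
      Matrix.sub_apply, SimpleGraph.degMatrix, Matrix.diagonal_apply, SimpleGraph.adjMatrix_apply]
    simp only [SimpleGraph.mem_neighborFinset, nsmul_eq_mul, mul_ite, mul_one, mul_zero]
    congr
  rw [hentry, sum_neighborFinset]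
  refine Finset.sum_congr rfl fun e _ => ?_
  simp only [incidence, eq_comm (b := j)]
  by_cases h1 : i = e.1.1 <;> by_cases h2 : i = e.1.2 <;> simp [h1, h2, eq_comm]
  · simp [← h1, ← h2]
  · simp [h1.symm.trans_ne h2]
  · have h3 : e.1.1 ≠ e.1.2 := fun h => h1 (h2.trans h.symm)
    simp [h3]

/-- Both the minor and the determinant with a unit row compute the same diagonal entry of the
adjugate. -/
theorem det_reducedLaplacian (P : PoseGraph N) (r : Fin (N + 1)) :
    (P.reducedLaplacian r).det = P.numSpanningTrees := by
  classical
  have h := Matrix.adjugate_fin_succ_eq_det_submatrix (P.graph.lapMatrix ℝ) r r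
  rw [Matrix.adjugate_apply, det_updateRow_lapMatrix, Even.neg_one_pow ⟨_, rfl⟩, one_mul] at h
  rw [numSpanningTrees, h, reducedLaplacian]

theorem numSpanningTrees_pos (P : PoseGraph N) : 0 < P.numSpanningTrees := by
  obtain ⟨T, hT, hT'⟩ := P.connected.exists_isTree_le
  exact (Set.ncard_pos (Set.toFinite _)).mpr ⟨T, hT, hT'⟩

theorem posDef_reducedLaplacian (P : PoseGraph N) (r : Fin (N + 1)) :
    (P.reducedLaplacian r).PosDef := by
  classical
  have h : (P.reducedLaplacian r).PosSemidef :=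
    (SimpleGraph.posSemidef_lapMatrix ℝ P.graph).submatrix _
  rw [h.posDef_iff_det_ne_zero, det_reducedLaplacian]
  exact_mod_cast P.numSpanningTrees_pos.ne'

/-- The change of coordinates at a node which turns rigid motions of the plane into constants. -/
def gaugeMatrix (P : PoseGraph N) (v : Fin (N + 1)) : Matrix (Fin 3) (Fin 3) ℝ :=
  !![1, 0, -P.pose v 1; 0, 1, P.pose v 0; 0, 0, 1]

/-- The anchored Jacobian in gauge coordinates. -/
noncomputable def gaugeJacobian (P : PoseGraph N) (r : Fin (N + 1)) :
    Matrix (P.meas × Fin 3) (Fin N × Fin 3) ℝ :=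
  Matrix.of fun ea kb =>
    P.gaugeMatrix ea.1.1.2 ea.2 kb.2 * incidence ea.1.1 (r.succAbove kb.1)

/-- With T_v the gauge matrix at v, an edge from i to j has block T_j at its target, and the lever
term turns -T_i at its source into -T_j. Each edge thus contributes one fixed matrix times its
signed incidence. -/
theorem exists_anchoredJacobian_mul_eq (P : PoseGraph N) (r : Fin (N + 1)) :
    ∃ D : Matrix (Fin N × Fin 3) (Fin N × Fin 3) ℝ, D.det = 1 ∧
      P.anchoredJacobian r * D = P.gaugeJacobian r := by
  refine ⟨(Matrix.blockDiagonal fun k => P.gaugeMatrix (r.succAbove k)).submatrix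
    (Equiv.prodComm _ _) (Equiv.prodComm _ _), ?_, ?_⟩
  · rw [Matrix.det_submatrix_equiv_self, Matrix.det_blockDiagonal]
    exact Finset.prod_eq_one fun k _ => by simp [gaugeMatrix, Matrix.det_fin_three]
  · ext ⟨e, a⟩ ⟨k, b⟩
    rw [Matrix.mul_apply, Fintype.sum_prod_type, Finset.sum_eq_single k]
    · simp only [anchoredJacobian, globalJacobian, gaugeJacobian, Matrix.submatrix_apply,
        Equiv.prodComm_apply, Prod.swap, Matrix.blockDiagonal_apply, if_true, Fin.sum_univ_three,
        Matrix.of_apply, Prod.map, id_eq]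
      by_cases h : r.succAbove k = e.1.1
      · rw [h]
        by_cases h' : e.1.1 = e.1.2
        all_goals
          fin_cases a <;> fin_cases b <;> simp [gaugeMatrix, lever, incidence, h']
        ring
      · by_cases h' : r.succAbove k = e.1.2
        · rw [h'] at h ⊢
          fin_cases a <;> fin_cases b <;> simp [gaugeMatrix, incidence, h]
        · fin_cases a <;> fin_cases b <;> simp [gaugeMatrix, incidence, h, h']
    · intro l _ hl
      refine Finset.sum_eq_zero fun c _ => ?_
      simp [Matrix.blockDiagonal_apply, hl]
    · simp

/-- The matrix which expresses coordinates relative to node `s` by those relative to `r`. -/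
def reanchor (r s : Fin (N + 1)) : Matrix (Fin N) (Fin N) ℤ :=
  Matrix.of fun k l => (if r.succAbove k = s.succAbove l then 1 else 0)
    - if r = s.succAbove l then 1 else 0

theorem reanchor_mul_reanchor (r s : Fin (N + 1)) : reanchor r s * reanchor s r = 1 := by
  ext k l
  -- The added term at `v = s` vanishes, so the sum may run over all nodes.
  have h := Fin.sum_univ_succAbove (fun v => ((if r.succAbove k = v then 1 else 0)
    - if r = v then 1 else 0) * ((if v = r.succAbove l then 1 else 0)
    - if s = r.succAbove l then (1 : ℤ) else 0)) s
  rw [sub_self, mul_zero, zero_add] at h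
  rw [Matrix.mul_apply]
  refine h.symm.trans ?_
  simp [sub_mul, Finset.sum_sub_distrib, Matrix.one_apply, (Fin.succAbove_ne r l).symm]

/-- Incidence rows sum to zero and therefore ignore the constant shift that `reanchor` subtracts. -/
theorem sum_incidence_mul_reanchor (e : Fin (N + 1) × Fin (N + 1)) (r s : Fin (N + 1))
    (l : Fin N) :
    ∑ k, incidence e (r.succAbove k) * (reanchor r s k l : ℝ) = incidence e (s.succAbove l) := by
  have h := Fin.sum_univ_succAbove (fun v => incidence e v *
    ((if v = s.succAbove l then 1 else 0) - if r = s.succAbove l then (1 : ℝ) else 0)) r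
  rw [sub_self, mul_zero, zero_add] at h
  simp only [reanchor, Matrix.of_apply, Int.cast_sub, Int.cast_ite, Int.cast_one, Int.cast_zero]
  rw [← h]
  simp only [mul_sub, Finset.sum_sub_distrib, ← Finset.sum_mul, sum_incidence, zero_mul, sub_zero]
  simp

/-- The determinant of the information matrix does not depend on the node that is held fixed. -/
theorem det_anchoredInfo_eq (P : PoseGraph N) (r s : Fin (N + 1)) (ω : Fin 3 → ℝ) :
    (P.anchoredInfo r ω).det = (P.anchoredInfo s ω).det := by
  have hg : ∀ r, (P.anchoredInfo r ω).det = (Matrix.transpose (P.gaugeJacobian r) *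
      Matrix.diagonal (fun ea : P.meas × Fin 3 => ω ea.2) * P.gaugeJacobian r).det := by
    intro r
    obtain ⟨D, hD, hJ⟩ := P.exists_anchoredJacobian_mul_eq r
    have : Matrix.transpose (P.gaugeJacobian r) *
        Matrix.diagonal (fun ea : P.meas × Fin 3 => ω ea.2) * P.gaugeJacobian r =
        Matrix.transpose D * P.anchoredInfo r ω * D := by
      rw [← hJ, Matrix.transpose_mul, anchoredInfo]
      simp only [Matrix.mul_assoc]
    rw [this, Matrix.det_mul, Matrix.det_mul, Matrix.det_transpose, hD, one_mul, mul_one]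
  let M : Matrix (Fin N × Fin 3) (Fin N × Fin 3) ℝ := Matrix.kroneckerMap (· * ·)
    ((Int.castRingHom ℝ).mapMatrix (reanchor r s)) (1 : Matrix (Fin 3) (Fin 3) ℝ)
  -- `reanchor` is an integer matrix with an integer inverse, so its determinant is ±1 and the
  -- square is 1.
  have hM : M.det * M.det = 1 := by
    have hu : IsUnit (reanchor r s).det :=
      IsUnit.of_mul_eq_one (reanchor s r).det
        (by rw [← Matrix.det_mul, reanchor_mul_reanchor, Matrix.det_one])
    have : (reanchor r s).det * (reanchor r s).det = 1 := Int.isUnit_mul_self hu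
    have h2 : ((reanchor r s).det : ℝ) * (reanchor r s).det = 1 := by exact_mod_cast this
    rw [Matrix.det_kronecker, Matrix.det_one, one_pow, mul_one, ← RingHom.map_det, ← mul_pow,
      eq_intCast, h2, one_pow]
  have hY : P.gaugeJacobian s = P.gaugeJacobian r * M := by
    ext ⟨e, a⟩ ⟨l, c⟩
    rw [Matrix.mul_apply, Fintype.sum_prod_type]
    simp only [gaugeJacobian, Matrix.of_apply, M, Matrix.kroneckerMap_apply, Matrix.one_apply,
      RingHom.mapMatrix_apply, Matrix.map_apply, eq_intCast, mul_ite, mul_one, mul_zero,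
      Finset.sum_ite_eq', Finset.mem_univ, if_true]
    rw [← sum_incidence_mul_reanchor e.1 r s l, Finset.mul_sum]
    exact Finset.sum_congr rfl fun k _ => mul_assoc _ _ _ |>.symm
  have : Matrix.transpose (P.gaugeJacobian s) *
      Matrix.diagonal (fun ea : P.meas × Fin 3 => ω ea.2) * P.gaugeJacobian s =
      Matrix.transpose M * (Matrix.transpose (P.gaugeJacobian r) *
      Matrix.diagonal (fun ea : P.meas × Fin 3 => ω ea.2) * P.gaugeJacobian r) * M := by
    rw [hY, Matrix.transpose_mul]
    simp only [Matrix.mul_assoc]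
  rw [hg, hg, this, Matrix.det_mul, Matrix.det_mul, Matrix.det_transpose]
  linear_combination -(Matrix.transpose (P.gaugeJacobian r) *
      Matrix.diagonal (fun ea : P.meas × Fin 3 => ω ea.2) * P.gaugeJacobian r).det * hM

end PoseGraph
end TBSP

/-! ### Block form of the information matrix and the entropy bounds -/

namespace TBSP
namespace PoseGraph

variable {N : ℕ}

/-- Sorting the coordinates of the poses into `x`, `y` and headings. -/
def coordEquiv (N : ℕ) : (Fin N ⊕ Fin N) ⊕ Fin N ≃ Fin N × Fin 3 where
  toFun := Sum.elim (Sum.elim (fun k => (k, 0)) fun k => (k, 1)) fun k => (k, 2)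
  invFun kb := ![Sum.inl (Sum.inl kb.1), Sum.inl (Sum.inr kb.1), Sum.inr kb.1] kb.2
  left_inv := by rintro ((k | k) | k) <;> rfl
  right_inv := by
    rintro ⟨k, b⟩
    fin_cases b <;> rfl

/-- The sum of the squared lengths of the edges measured from a node. -/
noncomputable def outDistSq (P : PoseGraph N) (i : Fin (N + 1)) : ℝ :=
  ∑ e : P.meas, if i = e.1.1 then P.lever e.1 0 ^ 2 + P.lever e.1 1 ^ 2 else 0

theorem outDistSq_le (P : PoseGraph N) (i : Fin (N + 1)) : P.outDistSq i ≤ P.distMaxSq := by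
  classical
  have h : P.outDistSq i ≤ ∑ j ∈ P.graph.neighborFinset i,
      ((P.pose i 0 - P.pose j 0) ^ 2 + (P.pose i 1 - P.pose j 1) ^ 2) := by
    rw [sum_neighborFinset, outDistSq]
    refine Finset.sum_le_sum fun e _ => ?_
    by_cases h : i = e.1.1
    · subst h
      simp only [if_true, lever, Matrix.cons_val_zero, Matrix.cons_val_one]
      refine le_add_of_le_of_nonneg (by nlinarith) ?_
      split_ifs <;> positivity
    · simp only [h, if_false, zero_add]
      split_ifs <;> positivity
  refine h.trans ?_
  rw [distMaxSq]
  convert Finset.le_sup' (f := fun i : Fin (N + 1) => ∑ j ∈ P.graph.neighborFinset i,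
    ((P.pose i 0 - P.pose j 0) ^ 2 + (P.pose i 1 - P.pose j 1) ^ 2)) (Finset.mem_univ i)

theorem outDistSq_nonneg (P : PoseGraph N) (i : Fin (N + 1)) : 0 ≤ P.outDistSq i := by
  refine Finset.sum_nonneg fun e _ => ?_
  split_ifs <;> positivity

/-- The coupling of the headings with coordinate `c` of the positions. -/
noncomputable def coupling (P : PoseGraph N) (r : Fin (N + 1)) (c : Fin 3) :
    Matrix (Fin N) (Fin N) ℝ :=
  Matrix.of fun k l => ∑ e : P.meas, incidence e.1 (r.succAbove k) *
    if r.succAbove l = e.1.1 then P.lever e.1 c else 0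

/-- A lever acts only on the heading of the source of its edge, so the lever products are diagonal.
The weight `c` enters through the heading Laplacian alone. -/
theorem anchoredInfo_submatrix (P : PoseGraph N) (r : Fin (N + 1)) (a c : ℝ) :
    (P.anchoredInfo r ![a, a, c]).submatrix (coordEquiv N) (coordEquiv N) =
      Matrix.fromBlocks
        (Matrix.fromBlocks (a • P.reducedLaplacian r) 0 0 (a • P.reducedLaplacian r))
        (Matrix.fromRows (a • P.coupling r 0) (a • P.coupling r 1))
        (Matrix.transpose (Matrix.fromRows (a • P.coupling r 0) (a • P.coupling r 1)))
        (c • P.reducedLaplacian r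
          + Matrix.diagonal fun k => a * P.outDistSq (r.succAbove k)) := by
  ext ((k | k) | k) ((l | l) | l)
  all_goals
    simp only [Matrix.submatrix_apply, coordEquiv, Equiv.coe_fn_mk, Sum.elim_inl, Sum.elim_inr,
      anchoredInfo, transpose_mul_diagonal_mul_apply, Fin.sum_univ_three, anchoredJacobian,
      globalJacobian, Matrix.of_apply, Prod.map, id_eq, Matrix.fromBlocks_apply₁₁,
      Matrix.fromBlocks_apply₁₂, Matrix.fromBlocks_apply₂₁, Matrix.fromBlocks_apply₂₂,
      Matrix.transpose_apply, Matrix.fromRows_apply_inl, Matrix.fromRows_apply_inr,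
      Matrix.smul_apply, Matrix.zero_apply, Matrix.add_apply, smul_eq_mul, coupling,
      reducedLaplacian_apply, Finset.mul_sum]
  case inr.inr =>
    rw [Matrix.diagonal_apply]
    have h : (if k = l then a * P.outDistSq (r.succAbove k) else 0) =
        ∑ e : P.meas, a * if k = l then
          (if r.succAbove k = e.1.1 then P.lever e.1 0 ^ 2 + P.lever e.1 1 ^ 2 else 0) else 0 := by
      split_ifs
      · rw [outDistSq, Finset.mul_sum]
      · simp
    rw [h, ← Finset.sum_add_distrib]
    refine Finset.sum_congr rfl fun e _ => ?_
    have hlever : P.lever e.1 2 = 0 := rfl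
    by_cases hkl : k = l
    · subst hkl
      by_cases h1 : r.succAbove k = e.1.1
      · simp [h1, hlever]
        ring
      · simp [h1]
    · have hne : r.succAbove k ≠ r.succAbove l := fun h => hkl (Fin.succAbove_right_injective h)
      by_cases h1 : r.succAbove k = e.1.1
      · have h2 : r.succAbove l ≠ e.1.1 := fun h => hne (h1.trans h.symm)
        simp [h1, h2, hkl, hlever]
      · simp [h1, hkl, hlever]
  all_goals
    first
    | exact Finset.sum_eq_zero fun e _ => by simp
    | refine Finset.sum_congr rfl fun e _ => ?_
      have hlever : P.lever e.1 2 = 0 := rfl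
      simp [hlever, mul_comm]

theorem posSemidef_anchoredInfo (P : PoseGraph N) (r : Fin (N + 1)) {ω : Fin 3 → ℝ}
    (hω : ∀ a, 0 ≤ ω a) : (P.anchoredInfo r ω).PosSemidef := by
  have h : (Matrix.diagonal fun ea : P.meas × Fin 3 => ω ea.2).PosSemidef :=
    Matrix.PosSemidef.diagonal fun ea => hω ea.2
  exact h.conjTranspose_mul_mul_same (P.anchoredJacobian r)

theorem posDef_smul_reducedLaplacian (P : PoseGraph N) (r : Fin (N + 1)) {a : ℝ} (ha : 0 < a) :
    (a • P.reducedLaplacian r).PosDef :=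
  (P.posDef_reducedLaplacian r).smul ha

theorem posDef_translationInfo (P : PoseGraph N) (r : Fin (N + 1)) {a : ℝ} (ha : 0 < a) :
    (Matrix.fromBlocks (a • P.reducedLaplacian r) 0 0 (a • P.reducedLaplacian r)).PosDef := by
  have h := P.posDef_smul_reducedLaplacian r ha
  let := h.isUnit.invertible
  have hs : (Matrix.fromBlocks (a • P.reducedLaplacian r) 0 0
      (a • P.reducedLaplacian r)).PosSemidef := by
    have := (Matrix.PosDef.fromBlocks₁₁ (0 : Matrix (Fin N) (Fin N) ℝ)
      (a • P.reducedLaplacian r) h).mpr (by simpa using h.posSemidef)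
    simpa using this
  rw [hs.posDef_iff_det_ne_zero, Matrix.det_fromBlocks_zero₂₁]
  exact mul_ne_zero h.det_pos.ne' h.det_pos.ne'

/-- This is the information matrix with heading measurements given weight zero, still a weighted
Gram matrix. -/
theorem posSemidef_fromBlocks_outDistSq (P : PoseGraph N) (r : Fin (N + 1)) {a : ℝ} (ha : 0 < a) :
    (Matrix.fromBlocks
      (Matrix.fromBlocks (a • P.reducedLaplacian r) 0 0 (a • P.reducedLaplacian r))
      (Matrix.fromRows (a • P.coupling r 0) (a • P.coupling r 1))
      (Matrix.transpose (Matrix.fromRows (a • P.coupling r 0) (a • P.coupling r 1)))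
      (Matrix.diagonal fun k => a * P.outDistSq (r.succAbove k))).PosSemidef := by
  have h := P.anchoredInfo_submatrix r a 0
  rw [zero_smul, zero_add] at h
  rw [← h]
  refine (P.posSemidef_anchoredInfo r fun b => ?_).submatrix _
  fin_cases b <;> simp [ha.le]

theorem le_det_anchoredInfo (P : PoseGraph N) (r : Fin (N + 1)) {a c : ℝ} (ha : 0 < a)
    (hc : 0 < c) :
    (a ^ N * P.numSpanningTrees) ^ 2 * (c ^ N * P.numSpanningTrees) ≤
      (P.anchoredInfo r ![a, a, c]).det := by
  have h := Matrix.det_mul_det_le_det_fromBlocks (P.posDef_translationInfo r ha)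
    (P.posDef_smul_reducedLaplacian r hc) (P.posSemidef_fromBlocks_outDistSq r ha)
  rw [← anchoredInfo_submatrix, Matrix.det_submatrix_equiv_self, Matrix.det_fromBlocks_zero₂₁,
    Matrix.det_smul, Matrix.det_smul, det_reducedLaplacian, Fintype.card_fin, ← sq] at h
  exact h

theorem det_anchoredInfo_le (P : PoseGraph N) (r : Fin (N + 1)) {a c : ℝ} (ha : 0 < a)
    (hc : 0 < c) :
    (P.anchoredInfo r ![a, a, c]).det ≤ (a ^ N * P.numSpanningTrees) ^ 2 *
      (c ^ N * (P.reducedLaplacian r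
        + (a / c * P.distMaxSq) • (1 : Matrix (Fin N) (Fin N) ℝ)).det) := by
  have h := Matrix.det_fromBlocks_le_det_mul_det (P.posDef_translationInfo r ha)
    (P.posDef_smul_reducedLaplacian r hc) (P.posSemidef_fromBlocks_outDistSq r ha)
  rw [← anchoredInfo_submatrix, Matrix.det_submatrix_equiv_self, Matrix.det_fromBlocks_zero₂₁,
    Matrix.det_smul, det_reducedLaplacian, Fintype.card_fin, ← sq] at h
  refine h.trans (mul_le_mul_of_nonneg_left ?_ (sq_nonneg _))
  have hC : (c • P.reducedLaplacian r
      + Matrix.diagonal fun k => a * P.outDistSq (r.succAbove k)).PosDef :=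
    (P.posDef_smul_reducedLaplacian r hc).add_posSemidef
      (Matrix.PosSemidef.diagonal fun k => mul_nonneg ha.le (P.outDistSq_nonneg _))
  -- This matrix raises every diagonal entry to the common value `a * P.distMaxSq`; dividing by `c`
  -- yields the shift of the Laplacian.
  have hE : (Matrix.diagonal fun k : Fin N =>
      a * (P.distMaxSq - P.outDistSq (r.succAbove k))).PosSemidef :=
    Matrix.PosSemidef.diagonal fun k => mul_nonneg ha.le (sub_nonneg.mpr (P.outDistSq_le _))
  refine (hC.det_le_det_add hE).trans_eq ?_
  have hcard : c ^ N = c ^ Fintype.card (Fin N) := by rw [Fintype.card_fin]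
  rw [hcard, ← Matrix.det_smul]
  congr 1
  rw [add_assoc, Matrix.diagonal_add, smul_add, smul_smul, Matrix.smul_one_eq_diagonal]
  congr 2
  funext k
  field_simp
  ring

theorem entropy_eq (P : PoseGraph N) (σp σθ : ℝ) :
    P.entropy σp σθ = (3 * N : ℝ) / 2 * Real.log (2 * Real.pi * Real.exp 1)
      - 1 / 2 * Real.log (P.infoMatrix σp σθ).det := by
  rw [entropy, posteriorCov, Matrix.det_nonsing_inv, Ring.inverse_eq_inv', Real.log_inv]
  ring

theorem sST_eq (P : PoseGraph N) {σp σθ : ℝ} (hσp : 0 < σp) (hσθ : 0 < σθ) :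
    P.sST σp σθ = 3 / 2 * P.tau + (N : ℝ) / 2 * (2 * Real.log (σp ^ 2)⁻¹ + Real.log (σθ ^ 2)⁻¹
      - 3 * Real.log (2 * Real.pi * Real.exp 1)) := by
  have hdet : (edgeInfo σp σθ).det = ((σp ^ 2)⁻¹) ^ 2 * (σθ ^ 2)⁻¹ := by
    rw [edgeInfo, Matrix.det_diagonal, Fin.prod_univ_three]
    simp only [Matrix.cons_val_zero, Matrix.cons_val_one, Matrix.cons_val]
    ring
  rw [sST, hdet, Real.log_mul (by positivity) (by positivity), Real.log_pow, Real.log_pow]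
  push_cast
  ring

theorem entropy_le_upperBound (P : PoseGraph N) {σp σθ : ℝ} (hσp : 0 < σp) (hσθ : 0 < σθ) :
    P.entropy σp σθ ≤ P.upperBound σp σθ := by
  have ht : (0 : ℝ) < P.numSpanningTrees := by exact_mod_cast P.numSpanningTrees_pos
  have ha : 0 < (σp ^ 2)⁻¹ := by positivity
  have hc : 0 < (σθ ^ 2)⁻¹ := by positivity
  have h := Real.log_le_log (by positivity) (P.le_det_anchoredInfo 0 ha hc)
  rw [Real.log_mul (by positivity) (by positivity), Real.log_pow,
    Real.log_mul (by positivity) (by positivity), Real.log_mul (by positivity) (by positivity),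
    Real.log_pow, Real.log_pow] at h
  rw [upperBound, entropy_eq, P.infoMatrix_eq hσp hσθ, P.sST_eq hσp hσθ, tau]
  push_cast at h
  linarith

/-- Only the two translational blocks contribute t(G) here; the heading block contributes the
shifted determinant, whence the correction by τ/2. -/
theorem lowerBound_le_entropy (P : PoseGraph N) {σp σθ : ℝ} (hσp : 0 < σp) (hσθ : 0 < σθ)
    (r : Fin (N + 1)) : P.lowerBound σp σθ r ≤ P.entropy σp σθ := by
  have ht : (0 : ℝ) < P.numSpanningTrees := by exact_mod_cast P.numSpanningTrees_pos
  have ha : 0 < (σp ^ 2)⁻¹ := by positivity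
  have hc : 0 < (σθ ^ 2)⁻¹ := by positivity
  have hpos : 0 < (P.anchoredInfo r ![(σp ^ 2)⁻¹, (σp ^ 2)⁻¹, (σθ ^ 2)⁻¹]).det :=
    lt_of_lt_of_le (by positivity) (P.le_det_anchoredInfo r ha hc)
  have hpsi : (σp ^ 2)⁻¹ / (σθ ^ 2)⁻¹ * P.distMaxSq = P.psi σp σθ := by
    rw [psi, div_pow]
    field_simp
  have hpsi0 : 0 ≤ P.psi σp σθ :=
    mul_nonneg (sq_nonneg _) ((P.outDistSq_nonneg 0).trans (P.outDistSq_le 0))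
  have hdet : 0 < (P.reducedLaplacian r
      + P.psi σp σθ • (1 : Matrix (Fin N) (Fin N) ℝ)).det :=
    ((P.posDef_reducedLaplacian r).add_posSemidef (Matrix.PosSemidef.one.smul hpsi0)).det_pos
  have h := Real.log_le_log hpos (P.det_anchoredInfo_le r ha hc)
  rw [hpsi, Real.log_mul (by positivity) (by positivity), Real.log_pow,
    Real.log_mul (by positivity) (by positivity), Real.log_mul (by positivity) (by positivity),
    Real.log_pow, Real.log_pow] at h
  rw [lowerBound, entropy_eq, P.infoMatrix_eq hσp hσθ, P.det_anchoredInfo_eq 0 r,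
    P.sST_eq hσp hσθ, tau]
  push_cast at h
  linarith

end PoseGraph
end TBSP

/-- `A` is the set of candidate actions; `G U` is the posterior pose graph of the action `U`, with
`N U` estimated poses; `r U` is the node at which its Laplacian is reduced. -/
theorem theorem1 {A : Type*} (σp σθ : ℝ) (hσp : 0 < σp) (hσθ : 0 < σθ)
    (N : A → ℕ) (G : (U : A) → TBSP.PoseGraph (N U)) (r : (U : A) → Fin (N U + 1))
    (Ustar Uhat : A)
    (hstar : ∀ U, (G Ustar).entropy σp σθ ≤ (G U).entropy σp σθ)
    (hhat : ∀ U, (G U).sST σp σθ ≤ (G Uhat).sST σp σθ)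
    (minLB : ℝ)
    (hminLB : IsLeast (Set.range fun U => (G U).lowerBound σp σθ (r U)) minLB) :
    (∀ U, (G U).lowerBound σp σθ (r U) ≤ (G U).entropy σp σθ ∧
      (G U).entropy σp σθ ≤ (G U).upperBound σp σθ) ∧
    TBSP.decisionError (fun U => (G U).entropy σp σθ) Ustar Uhat
      ≤ (G Uhat).upperBound σp σθ - minLB := by
  have hb := fun U => And.intro ((G U).lowerBound_le_entropy hσp hσθ (r U))
    ((G U).entropy_le_upperBound hσp hσθ)
  refine ⟨hb, ?_⟩
  -- Optimality of `Ustar` fixes the sign of the difference.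
  rw [TBSP.decisionError, abs_sub_comm, abs_of_nonneg (sub_nonneg.mpr (hstar Uhat))]
  exact sub_le_sub (hb Uhat).2 ((hminLB.2 ⟨Ustar, rfl⟩).trans (hb Ustar).1)
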